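/- A ribbon graph is a surface with boundary presented as a union of discs (vertices) and ribbons (edges). For a ribbon graph $G$ with edge set $E(G)$ and $A\subseteq E(G)$, let $G^{A}$ denote the partial dual of $G$ with respect to $A$, and let $\varepsilon(G)$ denote the Euler genus of $G$, i.e. $v-e+f=2c-\varepsilon(G)$, where $v,e,f,c$ are the numbers of vertices, edges, boundary components and connected components of $G$. The partial-dual Euler genus polynomial of $G$ is $${}^{\partial}\varepsilon_{G}(z)=\sum_{A\subseteq E(G)}z^{\varepsilon(G^{A})}.$$ A polynomial is called interpolating if the exponents occurring in it with nonzero coefficient form an interval of consecutive integers. A bouquet is a ribbon graph with exactly one vertex; its signed rotation is the cyclic sequence of the half-edges at the vertex, each labelled by its edge, where the two half-edges of an edge carry equal signs if the edge is an untwisted loop and different signs if it is a twisted loop (the sign $+$ is omitted). For $n\ge 1$, let $C_{2n+2}$ be the bouquet with the signed rotation $$(1,2,3,4,\dots,2n+1,2n+2,-2,-1,2n+1,2n+2,\dots,3,4),$$ where after $-1$ the pairs $2i+1,2i+2$ appear in the order $i=n,n-1,\dots,1$. Then $${}^{\partial}\varepsilon_{C_{2n+2}}(z)=2^{n+1}(n+2)z^{2n+2}+\sum_{s=2}^{n}2^{n+1}\left(\binom{n}{s}+\binom{n}{s-1}\right)z^{2n-2s+4}+2^{n+1}z^{2}.$$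 Moreover, for every $n\ge 1$ the ribbon graph $C_{2n+2}$ is non-orientable and ${}^{\partial}\varepsilon_{C_{2n+2}}(z)$ is not interpolating, so $C_{2n+2}$ is a counterexample to the conjecture that the partial-dual Euler genus polynomial of every non-orientable ribbon graph is interpolating. -/

import Mathlib

open Polynomial

/-- A ribbon graph (without isolated vertices), given by its flags. Every end of every edge-ribbon
carries two flags, one for each of its two corners. The map `t0` moves a flag along the side of the
ribbon to the other end of the edge, `t1` moves it along the boundary of the vertex-disc to the
nearest corner of the next ribbon end, and `t2` moves it across the end of the ribbon to the other
corner of the same end. -/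
structure RibbonGraph (F : Type*) where
  t0 : F → F
  t1 : F → F
  t2 : F → F
  t0_t0 : ∀ x, t0 (t0 x) = x
  t1_t1 : ∀ x, t1 (t1 x) = x
  t2_t2 : ∀ x, t2 (t2 x) = x
  t0_ne : ∀ x, t0 x ≠ x
  t1_ne : ∀ x, t1 x ≠ x
  t2_ne : ∀ x, t2 x ≠ x
  t0_t2 : ∀ x, t0 (t2 x) = t2 (t0 x)
  t0_t2_ne : ∀ x, t0 (t2 x) ≠ x

namespace RibbonGraph

variable {F : Type*} (G : RibbonGraph F)

/-- Vertices: the orbits of the group generated by `t1` and `t2`. -/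
def Vertex : Type _ := Quot fun x y : F => y = G.t1 x ∨ y = G.t2 x

/-- Edges: the orbits of the group generated by `t0` and `t2`. -/
def Edge : Type _ := Quot fun x y : F => y = G.t0 x ∨ y = G.t2 x

/-- Boundary components (faces): the orbits of the group generated by `t0` and `t1`. -/
def Face : Type _ := Quot fun x y : F => y = G.t0 x ∨ y = G.t1 x

/-- Connected components: the orbits of the group generated by `t0`, `t1` and `t2`. -/
def Component : Type _ := Quot fun x y : F => y = G.t0 x ∨ y = G.t1 x ∨ y = G.t2 x

/-- The edge to which a flag belongs. -/
def edgeOf (x : F) : G.Edge := Quot.mk _ x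

theorem edgeOf_t0 (x : F) : G.edgeOf (G.t0 x) = G.edgeOf x :=
  Eq.symm (Quot.sound (r := fun x y : F => y = G.t0 x ∨ y = G.t2 x) (Or.inl rfl))

theorem edgeOf_t2 (x : F) : G.edgeOf (G.t2 x) = G.edgeOf x :=
  Eq.symm (Quot.sound (r := fun x y : F => y = G.t0 x ∨ y = G.t2 x) (Or.inr rfl))

/-- The Euler genus `ε`, defined by Euler's formula `v - e + f = 2 c - ε`. (The integer
`2 c - v + e - f` is never negative, so `Int.toNat` only changes its type.) -/
noncomputable def eulerGenus : ℕ :=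
  (2 * (Nat.card G.Component : ℤ) - Nat.card G.Vertex + Nat.card G.Edge
    - Nat.card G.Face).toNat

/-- `G` is orientable if its flags can be coloured with two colours such that each of
`t0`, `t1`, `t2` changes the colour. -/
def Orientable : Prop :=
  ∃ c : F → Bool, ∀ x, c (G.t0 x) = !c x ∧ c (G.t1 x) = !c x ∧ c (G.t2 x) = !c x

open Classical in
/-- The partial dual `G ^ A`: the roles of `t0` and `t2` (that is, of the sides and the ends of the
ribbon) are exchanged on the edges in `A`. In particular the vertices of `G ^ A` are the boundary
components of the spanning ribbon subgraph with edge set `A`. -/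
noncomputable def partialDual (A : Set G.Edge) : RibbonGraph F where
  t0 x := if G.edgeOf x ∈ A then G.t2 x else G.t0 x
  t1 := G.t1
  t2 x := if G.edgeOf x ∈ A then G.t0 x else G.t2 x
  t0_t0 x := by by_cases h : G.edgeOf x ∈ A <;> simp [h, edgeOf_t0, edgeOf_t2, G.t0_t0, G.t2_t2]
  t1_t1 := G.t1_t1
  t2_t2 x := by by_cases h : G.edgeOf x ∈ A <;> simp [h, edgeOf_t0, edgeOf_t2, G.t0_t0, G.t2_t2]
  t0_ne x := by by_cases h : G.edgeOf x ∈ A <;> simp [h, G.t0_ne, G.t2_ne]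
  t1_ne := G.t1_ne
  t2_ne x := by by_cases h : G.edgeOf x ∈ A <;> simp [h, G.t0_ne, G.t2_ne]
  t0_t2 x := by by_cases h : G.edgeOf x ∈ A <;> simp [h, edgeOf_t0, edgeOf_t2, G.t0_t2]
  t0_t2_ne x := by
    by_cases h : G.edgeOf x ∈ A
    · simpa [h, edgeOf_t0, G.t0_t2] using G.t0_t2_ne x
    · simpa [h, edgeOf_t2] using G.t0_t2_ne x

/-- The partial-dual Euler genus polynomial, the sum of `z ^ ε(G ^ A)` over all sets `A` of edges
(finitely many, since there are finitely many flags). -/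
noncomputable def partialDualEulerGenusPoly [Finite F] : ℤ[X] :=
  ∑ᶠ A : Set G.Edge, X ^ (G.partialDual A).eulerGenus

end RibbonGraph

/-- A polynomial is interpolating if the exponents that occur in it with a nonzero coefficient form
an interval of integers. -/
def IsInterpolating (p : ℤ[X]) : Prop := (p.support : Set ℕ).OrdConnected

/-- A word in the nonzero integers, read cyclically, is a signed rotation if every edge label
(absolute value of a letter) occurs exactly twice. -/
def IsSignedRotation (w : List ℤ) : Prop :=
  0 ∉ w ∧ ∀ x ∈ w, (w.map Int.natAbs).count x.natAbs = 2

namespace IsSignedRotation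

variable {w : List ℤ}

theorem existsUnique_partner (hw : IsSignedRotation w) (i : Fin w.length) :
    ∃! j : Fin w.length, j ≠ i ∧ w[j].natAbs = w[i].natAbs := by
  have hc := hw.2 w[i] (List.getElem_mem _)
  have h := Fin.card_filter_univ_eq_vector_get_eq_count w[i].natAbs
    (⟨w.map Int.natAbs, List.length_map _⟩ : List.Vector ℕ w.length)
  rw [List.Vector.toList_mk, hc, Finset.card_eq_two] at h
  obtain ⟨a, b, hab, hs⟩ := h
  have key : ∀ j : Fin w.length, w[j].natAbs = w[i].natAbs ↔ j = a ∨ j = b := by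
    intro j
    have := Finset.ext_iff.1 hs j
    simpa [List.Vector.get, eq_comm] using this
  rcases (key i).1 rfl with rfl | rfl
  · exact ⟨b, ⟨hab.symm, (key b).2 (Or.inr rfl)⟩, fun j hj => ((key j).1 hj.2).resolve_left hj.1⟩
  · exact ⟨a, ⟨hab, (key a).2 (Or.inl rfl)⟩, fun j hj => ((key j).1 hj.2).resolve_right hj.1⟩

/-- The position of the other half-edge of the edge whose half-edge is at position `i`. -/
noncomputable def partner (hw : IsSignedRotation w) (i : Fin w.length) : Fin w.length :=
  (hw.existsUnique_partner i).choose

theorem partner_ne (hw : IsSignedRotation w) (i : Fin w.length) : hw.partner i ≠ i :=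
  (hw.existsUnique_partner i).choose_spec.1.1

theorem natAbs_partner (hw : IsSignedRotation w) (i : Fin w.length) :
    w[hw.partner i].natAbs = w[i].natAbs :=
  (hw.existsUnique_partner i).choose_spec.1.2

theorem partner_partner (hw : IsSignedRotation w) (i : Fin w.length) :
    hw.partner (hw.partner i) = i :=
  (hw.existsUnique_partner (hw.partner i)).unique
    ⟨hw.partner_ne _, hw.natAbs_partner _⟩ ⟨(hw.partner_ne i).symm, (hw.natAbs_partner i).symm⟩

/-- The edge at position `i` is a twisted loop: its two half-edges have different signs. -/
def Twisted (hw : IsSignedRotation w) (i : Fin w.length) : Prop :=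
  w[hw.partner i].sign ≠ w[i].sign

theorem twisted_partner (hw : IsSignedRotation w) (i : Fin w.length) :
    hw.Twisted (hw.partner i) ↔ hw.Twisted i := by
  simp only [Twisted, partner_partner]
  exact ne_comm

open Classical in
/-- The bouquet with signed rotation `w`. Going once around the boundary of the vertex-disc one
meets the half-edges at the positions `0, 1, 2, …` of `w`; of the half-edge at position `i` one
meets first the corner `(i, false)` and then the corner `(i, true)`. The sides of an untwisted
ribbon join the second corner of each end with the first corner of the other end, those of a
twisted ribbon join the first corners of the two ends and the second corners of the two ends. -/
noncomputable def bouquet (hw : IsSignedRotation w) : RibbonGraph (Fin w.length × Bool) where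
  t0 x := (hw.partner x.1, if hw.Twisted x.1 then x.2 else !x.2)
  t1 x := if x.2 then (finRotate _ x.1, false) else ((finRotate _).symm x.1, true)
  t2 x := (x.1, !x.2)
  t0_t0 x := by
    by_cases h : hw.Twisted x.1 <;> simp [h, partner_partner, twisted_partner]
  t1_t1 x := by
    rcases x with ⟨i, _ | _⟩
    · exact Prod.ext ((finRotate _).apply_symm_apply i) rfl
    · exact Prod.ext ((finRotate _).symm_apply_apply i) rfl
  t2_t2 x := by simp
  t0_ne x h := hw.partner_ne x.1 (congrArg Prod.fst h)
  t1_ne x := by rcases x with ⟨i, _ | _⟩ <;> simp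
  t2_ne x := by rcases x with ⟨i, _ | _⟩ <;> simp
  t0_t2 x := by by_cases h : hw.Twisted x.1 <;> simp [h]
  t0_t2_ne x h := hw.partner_ne x.1 (congrArg Prod.fst h)

end IsSignedRotation

/-- The signed rotation `(1, 2, 3, 4, …, 2n+1, 2n+2, -2, -1, 2n+1, 2n+2, …, 3, 4)`. -/
def rotationC (n : ℕ) : List ℤ :=
  [1, 2] ++ (List.range n).flatMap (fun i : ℕ => [2 * (i : ℤ) + 3, 2 * (i : ℤ) + 4])
    ++ [-2, -1] ++ (List.range n).reverse.flatMap (fun i : ℕ => [2 * (i : ℤ) + 3, 2 * (i : ℤ) + 4])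

theorem isSignedRotation_rotationC (n : ℕ) : IsSignedRotation (rotationC n) := by
  have hblock : ∀ m k : ℕ, ((List.range m).flatMap fun i => [2 * i + 3, 2 * i + 4]).count k =
      if 3 ≤ k ∧ k < 2 * m + 3 then 1 else 0 := by
    intro m k
    induction m with
    | zero => simp
    | succ m ih =>
      rw [List.range_succ, List.flatMap_append, List.count_append, ih]
      simp only [List.flatMap_singleton, List.count_cons, List.count_nil, beq_iff_eq]
      split_ifs <;> omega
  have hmap : ∀ l : List ℕ,
      (l.flatMap fun i : ℕ => [2 * (i : ℤ) + 3, 2 * (i : ℤ) + 4]).map Int.natAbs =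
        l.flatMap fun i => [2 * i + 3, 2 * i + 4] := by
    intro l
    rw [List.map_flatMap]
    have : ∀ i : ℕ, [2 * (i : ℤ) + 3, 2 * (i : ℤ) + 4].map Int.natAbs = [2 * i + 3, 2 * i + 4] := by
      intro i
      simp only [List.map_cons, List.map_nil, List.cons.injEq, and_true]
      omega
    simp only [this]
  have hrev : ∀ k : ℕ, ((List.range n).reverse.flatMap fun i => [2 * i + 3, 2 * i + 4]).count k =
      ((List.range n).flatMap fun i => [2 * i + 3, 2 * i + 4]).count k := fun k =>
    ((List.reverse_perm _).flatMap_right _).count_eq k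
  refine ⟨by simp [rotationC]; omega, fun x hx => ?_⟩
  have hx' : 1 ≤ x.natAbs ∧ x.natAbs < 2 * n + 3 := by
    simp only [rotationC, List.mem_append, List.mem_cons, List.mem_flatMap, List.mem_range,
      List.mem_reverse, List.not_mem_nil, or_false] at hx
    rcases hx with ((hx | ⟨i, hi, hx⟩) | hx) | ⟨i, hi, hx⟩ <;> omega
  simp only [rotationC, List.map_append, hmap, List.count_append, hrev, hblock, List.map_cons,
    List.map_nil, List.count_cons, List.count_nil, beq_iff_eq]
  have h1 : (1 : ℤ).natAbs = 1 := rfl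
  have h2 : (2 : ℤ).natAbs = 2 := rfl
  simp only [Int.natAbs_neg, h1, h2]
  split_ifs <;> omega

/-- The bouquet `C_{2n+2}`. -/
noncomputable def bouquetC (n : ℕ) : RibbonGraph (Fin (rotationC n).length × Bool) :=
  (isSignedRotation_rotationC n).bouquet

/-! Let `f(A)` be the number of boundary components of the spanning subgraph with edge set `A`. The
vertices of the partial dual by `A` number `f(A)`, its faces `f(Aᶜ)`, and it is connected with
`2n+2` edges, so its Euler genus is `2n + 4 - f(A) - f(Aᶜ)`.

To find `f(A)`, follow the arcs of the vertex boundary as two strands, `L` on the left and `R` on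
the right, past the pairs `{2i+1, 2i+2}`, `1 ≤ i ≤ n`. A pair with both or neither of its edges in
`A` lets both strands through; a pair with exactly one (a single) makes them turn back into each
other on both sides. Thus `s` singles cut the ladder into `s + 1` segments. The twisted pair `{1,
2}` either caps both ends, giving `f(A) = s + 1`, or, when it is itself a single, glues the two ends
together, giving `max s 1` (`IsGapLabelling.card_of_universal`).

Complementation preserves singles, so `f(Aᶜ) = f(A)` and every exponent is even
(`eulerGenus_partialDual_bouquetC`). The genus depends only on which pairs are singles; each such
choice arises from `2^(n+1)` sets `A`, and binomial counting gives the polynomial. Exponents `2` and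
`2n+2 ≥ 4` occur while `3` does not. -/

/-! ### Labellings of the arcs and the number of their values. -/

/-- The equations satisfied by a function that is constant on the boundary components of a spanning
ribbon subgraph of `C_{2n+2}`. The arcs of the vertex boundary between consecutive half-edges are
`L i` and `R i` (between the `i`-th and the next pair of edges, on the left and on the right) and
`U i` and `V i` (between the two edges of the `i`-th pair). The edges `2i+1` and `2i+2` belong to
the subgraph if `a i` and `b i` hold. -/
structure IsGapLabelling {T : Type*} (n : ℕ) (a b : ℕ → Prop) (L R U V : ℕ → T) : Prop where
  fst_of_not : ∀ i < n, ¬ a (i + 1) → U (i + 1) = L i ∧ V (i + 1) = R (i + 1)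
  fst_of_mem : ∀ i < n, a (i + 1) → U (i + 1) = R (i + 1) ∧ V (i + 1) = L i
  snd_of_not : ∀ i < n, ¬ b (i + 1) → L (i + 1) = U (i + 1) ∧ R i = V (i + 1)
  snd_of_mem : ∀ i < n, b (i + 1) → L (i + 1) = V (i + 1) ∧ R i = U (i + 1)
  fst_zero_of_not : ¬ a 0 → U 0 = R 0 ∧ V 0 = R n
  fst_zero_of_mem : a 0 → U 0 = R n ∧ V 0 = R 0
  snd_zero_of_not : ¬ b 0 → L 0 = U 0 ∧ L n = V 0
  snd_zero_of_mem : b 0 → L 0 = V 0 ∧ L n = U 0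

open Classical in
/-- The number of `j` with `1 ≤ j ≤ i` for which exactly one of `a j` and `b j` holds. -/
noncomputable def singleCount (a b : ℕ → Prop) (i : ℕ) : ℕ :=
  ∑ j ∈ Finset.range i, if a (j + 1) ↔ b (j + 1) then 0 else 1

section singleCount

variable {a b : ℕ → Prop}

theorem singleCount_zero : singleCount a b 0 = 0 := by simp [singleCount]

theorem singleCount_succ_of_iff {i : ℕ} (h : a (i + 1) ↔ b (i + 1)) :
    singleCount a b (i + 1) = singleCount a b i := by
  simp [singleCount, Finset.sum_range_succ, h]

theorem singleCount_succ_of_not_iff {i : ℕ} (h : ¬ (a (i + 1) ↔ b (i + 1))) :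
    singleCount a b (i + 1) = singleCount a b i + 1 := by
  simp only [singleCount, Finset.sum_range_succ, if_neg h]

theorem singleCount_mono : Monotone (singleCount a b) := by
  refine monotone_nat_of_le_succ fun i => ?_
  by_cases h : a (i + 1) ↔ b (i + 1)
  · rw [singleCount_succ_of_iff h]
  · rw [singleCount_succ_of_not_iff h]; omega

/-- Discrete intermediate values: the count starts at `0` and each step adds at most `1`. -/
theorem exists_singleCount_eq {n k : ℕ} (hk : k ≤ singleCount a b n) :
    ∃ i ≤ n, singleCount a b i = k := by
  induction n with
  | zero => exact ⟨0, le_rfl, by rw [singleCount_zero] at *; omega⟩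
  | succ n ih =>
    by_cases hkn : k ≤ singleCount a b n
    · obtain ⟨i, hi, h⟩ := ih hkn
      exact ⟨i, by omega, h⟩
    · refine ⟨n + 1, le_rfl, ?_⟩
      by_cases h : a (n + 1) ↔ b (n + 1)
      · rw [singleCount_succ_of_iff h] at *; omega
      · rw [singleCount_succ_of_not_iff h] at *; omega

end singleCount

namespace IsGapLabelling

variable {T : Type*} {n : ℕ} {a b : ℕ → Prop} {L R U V : ℕ → T}

/-- With both edges absent each strand stays on its side; with both present it crosses over and
back. -/
theorem succ_of_iff (h : IsGapLabelling n a b L R U V) {i : ℕ} (hi : i < n)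
    (hab : a (i + 1) ↔ b (i + 1)) : L (i + 1) = L i ∧ R (i + 1) = R i := by
  by_cases ha : a (i + 1)
  · have h1 := h.fst_of_mem i hi ha
    have h2 := h.snd_of_mem i hi (hab.1 ha)
    exact ⟨h2.1.trans h1.2, (h2.2.trans h1.1).symm⟩
  · have h1 := h.fst_of_not i hi ha
    have h2 := h.snd_of_not i hi (fun hb => ha (hab.2 hb))
    exact ⟨h2.1.trans h1.1, (h2.2.trans h1.2).symm⟩

/-- With only one edge present a strand crosses once, so it returns along the other side. -/
theorem eq_of_not_iff (h : IsGapLabelling n a b L R U V) {i : ℕ} (hi : i < n)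
    (hab : ¬ (a (i + 1) ↔ b (i + 1))) : L i = R i ∧ L (i + 1) = R (i + 1) := by
  by_cases ha : a (i + 1)
  · have h1 := h.fst_of_mem i hi ha
    have h2 := h.snd_of_not i hi (fun hb => hab ⟨fun _ => hb, fun _ => ha⟩)
    exact ⟨(h2.2.trans h1.2).symm, h2.1.trans h1.1⟩
  · have h1 := h.fst_of_not i hi ha
    have h2 := h.snd_of_mem i hi (by tauto)
    exact ⟨(h2.2.trans h1.1).symm, h2.1.trans h1.2⟩

theorem left_eq_right_iff (h : IsGapLabelling n a b L R U V) {i : ℕ} (hi : i ≤ n) :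
    L i = R i ↔ L 0 = R 0 := by
  induction i with
  | zero => rfl
  | succ i ih =>
    rw [← ih (by omega)]
    by_cases hab : a (i + 1) ↔ b (i + 1)
    · rw [(h.succ_of_iff hi hab).1, (h.succ_of_iff hi hab).2]
    · exact iff_of_true (h.eq_of_not_iff hi hab).2 (h.eq_of_not_iff hi hab).1

theorem eq_of_singleCount_eq (h : IsGapLabelling n a b L R U V) {i j : ℕ} (hij : i ≤ j)
    (hj : j ≤ n) (hs : singleCount a b i = singleCount a b j) : L i = L j ∧ R i = R j := by
  induction j, hij using Nat.le_induction with
  | base => exact ⟨rfl, rfl⟩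
  | succ j hij ih =>
    have hm : singleCount a b i ≤ singleCount a b j := singleCount_mono hij
    by_cases hab : a (j + 1) ↔ b (j + 1)
    · rw [singleCount_succ_of_iff hab] at hs
      rw [(h.succ_of_iff hj hab).1, (h.succ_of_iff hj hab).2]
      exact ih (by omega) hs
    · rw [singleCount_succ_of_not_iff hab] at hs
      omega

theorem left_eq_of_singleCount_eq (h : IsGapLabelling n a b L R U V) {i j : ℕ} (hi : i ≤ n)
    (hj : j ≤ n) (hs : singleCount a b i = singleCount a b j) : L i = L j := by
  rcases le_total i j with hij | hij
  · exact (h.eq_of_singleCount_eq hij hj hs).1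
  · exact (h.eq_of_singleCount_eq hij hi hs.symm).1.symm

theorem zero_eq_of_iff (h : IsGapLabelling n a b L R U V) (hab : a 0 ↔ b 0) : L 0 = R 0 := by
  by_cases ha : a 0
  · exact (h.snd_zero_of_mem (hab.1 ha)).1.trans (h.fst_zero_of_mem ha).2
  · exact (h.snd_zero_of_not (fun hb => ha (hab.2 hb))).1.trans (h.fst_zero_of_not ha).1

/-- The pair `0` is twisted and its half-edges separate the two ends of the ladder, so here a single
connects opposite ends instead of capping them. -/
theorem zero_eq_of_not_iff (h : IsGapLabelling n a b L R U V) (hab : ¬ (a 0 ↔ b 0)) :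
    L 0 = R n ∧ L n = R 0 := by
  by_cases ha : a 0
  · have h1 := h.fst_zero_of_mem ha
    have h2 := h.snd_zero_of_not (fun hb => hab ⟨fun _ => hb, fun _ => ha⟩)
    exact ⟨h2.1.trans h1.1, h2.2.trans h1.2⟩
  · have h1 := h.fst_zero_of_not ha
    have h2 := h.snd_zero_of_mem (by tauto)
    exact ⟨h2.1.trans h1.2, h2.2.trans h1.1⟩

/-- One single identifies the two strands next to it, and `left_eq_right_iff` carries this to every
level. -/
theorem eq_zero_or_left_eq_right (h : IsGapLabelling n a b L R U V) :
    singleCount a b n = 0 ∨ ∀ i ≤ n, L i = R i := by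
  by_cases hex : ∃ j < n, ¬ (a (j + 1) ↔ b (j + 1))
  · obtain ⟨j, hj, hab⟩ := hex
    right
    intro i hi
    rw [h.left_eq_right_iff hi, ← h.left_eq_right_iff hj.le]
    exact (h.eq_of_not_iff hj hab).1
  · left
    push Not at hex
    exact Finset.sum_eq_zero fun j hj => if_pos (hex j (Finset.mem_range.1 hj))

theorem left_zero_eq_of_not_iff (h : IsGapLabelling n a b L R U V) (hab : ¬ (a 0 ↔ b 0)) :
    L 0 = L n := by
  rcases h.eq_zero_or_left_eq_right with hs | hLR
  · exact h.left_eq_of_singleCount_eq (Nat.zero_le n) le_rfl (by rw [hs, singleCount_zero])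
  · rw [(h.zero_eq_of_not_iff hab).1, hLR n le_rfl]

/-- Needed so that values can be counted on the left strand alone. -/
theorem exists_right_eq_left (h : IsGapLabelling n a b L R U V) {i : ℕ} (hi : i ≤ n) :
    ∃ j ≤ n, R i = L j := by
  by_cases hab : a 0 ↔ b 0
  · exact ⟨i, hi, ((h.left_eq_right_iff hi).2 (h.zero_eq_of_iff hab)).symm⟩
  rcases h.eq_zero_or_left_eq_right with hs | hLR
  · refine ⟨n, le_rfl, ?_⟩
    rw [(h.zero_eq_of_not_iff hab).2]
    refine ((h.eq_of_singleCount_eq (Nat.zero_le i) hi ?_).2).symm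
    have := singleCount_mono (a := a) (b := b) hi
    rw [singleCount_zero]
    omega
  · exact ⟨i, hi, (hLR i hi).symm⟩

theorem exists_eq_left (h : IsGapLabelling n a b L R U V) {q : T} {i : ℕ} (hi : i ≤ n)
    (hq : q = L i ∨ q = R i ∨ q = U i ∨ q = V i) : ∃ j ≤ n, q = L j := by
  have hLR : ∀ {q : T} {i : ℕ}, i ≤ n → (q = L i ∨ q = R i) → ∃ j ≤ n, q = L j := by
    rintro q i hi (rfl | rfl)
    · exact ⟨i, hi, rfl⟩
    · exact h.exists_right_eq_left hi
  rcases hq with hq | hq | hq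
  · exact hLR hi (.inl hq)
  · exact hLR hi (.inr hq)
  rcases i with _ | i
  · by_cases ha : a 0
    · obtain ⟨h1, h2⟩ := h.fst_zero_of_mem ha
      rw [h1, h2] at hq
      exact hq.elim (fun e => hLR le_rfl (.inr e)) (fun e => hLR (Nat.zero_le n) (.inr e))
    · obtain ⟨h1, h2⟩ := h.fst_zero_of_not ha
      rw [h1, h2] at hq
      exact hq.elim (fun e => hLR (Nat.zero_le n) (.inr e)) (fun e => hLR le_rfl (.inr e))
  · have hi' : i ≤ n := by omega
    by_cases ha : a (i + 1)
    · obtain ⟨h1, h2⟩ := h.fst_of_mem i hi ha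
      rw [h1, h2] at hq
      exact hq.elim (fun e => hLR hi (.inr e)) (fun e => hLR hi' (.inl e))
    · obtain ⟨h1, h2⟩ := h.fst_of_not i hi ha
      rw [h1, h2] at hq
      exact hq.elim (fun e => hLR hi' (.inl e)) (fun e => hLR hi (.inr e))

open Classical in
/-- Counting the singles passed so far is a labelling, once the two ends get the same label in
case exactly one of `a 0` and `b 0` holds. -/
theorem exists_of_singleCount (n : ℕ) (a b : ℕ → Prop) (f : ℕ → T)
    (hf : ¬ (a 0 ↔ b 0) → f 0 = f (singleCount a b n)) :
    ∃ U V : ℕ → T, IsGapLabelling n a b (fun i => f (singleCount a b i))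
      (fun i => f (singleCount a b i)) U V := by
  -- The equations of the first edge of each pair dictate `U` and `V`; those of the second edge are
  -- then to be checked.
  refine ⟨fun i => if i = 0 then (if a 0 then f (singleCount a b n) else f 0) else
      if a i then f (singleCount a b i) else f (singleCount a b (i - 1)),
    fun i => if i = 0 then (if a 0 then f 0 else f (singleCount a b n)) else
      if a i then f (singleCount a b (i - 1)) else f (singleCount a b i), ?_⟩
  constructor
  · intro i _ ha; simp [ha]
  · intro i _ ha; simp [ha]
  · intro i _ hb
    by_cases ha : a (i + 1)
    · simp [ha]
    · simp [ha, singleCount_succ_of_iff (iff_of_false ha hb)]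
  · intro i _ hb
    by_cases ha : a (i + 1)
    · simp [ha, singleCount_succ_of_iff (iff_of_true ha hb)]
    · simp [ha]
  · intro ha; simp [ha, singleCount_zero]
  · intro ha; simp [ha, singleCount_zero]
  · intro hb
    by_cases ha : a 0
    · simp [ha, singleCount_zero, hf (by tauto)]
    · simp [ha, singleCount_zero]
  · intro hb
    by_cases ha : a 0
    · simp [ha, singleCount_zero]
    · simp [ha, singleCount_zero, hf (by tauto)]

open Classical in
/-- A universal labelling has `s + 1` or `max s 1` values, where `s` is the number of singles. -/
theorem card_of_universal (h : IsGapLabelling n a b L R U V)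
    (hsurj : ∀ q, ∃ i ≤ n, q = L i ∨ q = R i ∨ q = U i ∨ q = V i)
    (huniv : ∀ L' R' U' V' : ℕ → ℕ, IsGapLabelling n a b L' R' U' V' →
      ∃ f : T → ℕ, ∀ i ≤ n, f (L i) = L' i) :
    Nat.card T = if a 0 ↔ b 0 then singleCount a b n + 1 else max (singleCount a b n) 1 := by
  have hL : ∀ q, ∃ i ≤ n, q = L i := fun q => by
    obtain ⟨i, hi, hq⟩ := hsurj q
    exact h.exists_eq_left hi hq
  have hle : ∀ i ≤ n, singleCount a b i ≤ singleCount a b n := fun i hi => singleCount_mono hi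
  have card_eq : ∀ (f : T → ℕ) (m : ℕ), Function.Injective f → Set.range f = Set.Iio m →
      Nat.card T = m := by
    intro f m hf hr
    rw [← Nat.card_range_of_injective hf, hr]
    simp
  split_ifs with hab
  -- Number the segments `0, …, s`. Universality makes the number a function on `T`; it is injective
  -- because equal counts force equal labels.
  · obtain ⟨U', V', h'⟩ := exists_of_singleCount n a b (id : ℕ → ℕ) (fun hn => absurd hab hn)
    obtain ⟨f, hf⟩ := huniv _ _ _ _ h'
    refine card_eq f _ ?_ ?_
    · intro p q hpq
      obtain ⟨i, hi, rfl⟩ := hL p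
      obtain ⟨j, hj, rfl⟩ := hL q
      rw [hf i hi, hf j hj] at hpq
      exact h.left_eq_of_singleCount_eq hi hj hpq
    · ext k
      simp only [Set.mem_range, Set.mem_Iio]
      constructor
      · rintro ⟨q, rfl⟩
        obtain ⟨i, hi, rfl⟩ := hL q
        rw [hf i hi]
        exact Nat.lt_succ_of_le (hle i hi)
      · intro hk
        obtain ⟨i, hi, rfl⟩ := exists_singleCount_eq (Nat.le_of_lt_succ hk)
        exact ⟨L i, hf i hi⟩
  -- The last segment is glued to the first, so its number `s` is replaced by `0`. The numbers below
  -- `s` remain, or just `0` if `s = 0`.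
  · obtain ⟨U', V', h'⟩ := exists_of_singleCount n a b
      (fun k => if k = singleCount a b n then 0 else k) (fun _ => by simp)
    obtain ⟨f, hf⟩ := huniv _ _ _ _ h'
    have h0 := h.left_zero_eq_of_not_iff hab
    have hz : ∀ i ≤ n, singleCount a b i = 0 → L i = L 0 := fun i hi hs =>
      h.left_eq_of_singleCount_eq hi (Nat.zero_le n) (by rw [hs, singleCount_zero])
    have hs : ∀ i ≤ n, singleCount a b i = singleCount a b n → L i = L 0 := fun i hi hs =>
      (h.left_eq_of_singleCount_eq hi le_rfl hs).trans h0.symm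
    refine card_eq f _ ?_ ?_
    · intro p q hpq
      obtain ⟨i, hi, rfl⟩ := hL p
      obtain ⟨j, hj, rfl⟩ := hL q
      rw [hf i hi, hf j hj] at hpq
      split_ifs at hpq with h1 h2 h2
      · rw [hs i hi h1, hs j hj h2]
      · rw [hs i hi h1, hz j hj hpq.symm]
      · rw [hz i hi hpq, hs j hj h2]
      · exact h.left_eq_of_singleCount_eq hi hj hpq
    · ext k
      simp only [Set.mem_range, Set.mem_Iio]
      constructor
      · rintro ⟨q, rfl⟩
        obtain ⟨i, hi, rfl⟩ := hL q
        rw [hf i hi]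
        have := hle i hi
        split_ifs <;> omega
      · intro hk
        by_cases hk0 : k = 0
        · refine ⟨L n, ?_⟩
          rw [hf n le_rfl, hk0]
          simp
        · obtain ⟨i, hi, rfl⟩ := exists_singleCount_eq (a := a) (b := b) (n := n) (k := k)
            (by omega)
          refine ⟨L i, ?_⟩
          rw [hf i hi]
          exact if_neg (by omega)

end IsGapLabelling

/-! ### The letters of the rotation by position. -/

theorem List.flatMap_range_pair (n : ℕ) :
    (List.range n).flatMap (fun i : ℕ => [2 * (i : ℤ) + 3, 2 * (i : ℤ) + 4]) =
      (List.range (2 * n)).map fun k : ℕ => (k : ℤ) + 3 := by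
  induction n with
  | zero => simp
  | succ n ih =>
    rw [List.range_succ, List.flatMap_append, ih, show 2 * (n + 1) = 2 * n + 1 + 1 by ring,
      List.range_succ, List.range_succ]
    simp
    ring

/-- The pairs come in reverse order but each pair stays increasing, hence the dependence on parity.
-/
theorem List.flatMap_reverse_range_pair (n : ℕ) :
    (List.range n).reverse.flatMap (fun i : ℕ => [2 * (i : ℤ) + 3, 2 * (i : ℤ) + 4]) =
      (List.range (2 * n)).map fun k : ℕ =>
        if k % 2 = 0 then 2 * (n : ℤ) + 1 - k else 2 * (n : ℤ) + 3 - k := by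
  induction n with
  | zero => simp
  | succ n ih =>
    rw [List.range_succ, List.reverse_append, List.flatMap_append, ih,
      show 2 * (n + 1) = 2 * n + 1 + 1 by ring, List.range_succ_eq_map, List.range_succ_eq_map]
    simp only [List.reverse_cons, List.reverse_nil, List.nil_append, List.flatMap_cons,
      List.flatMap_nil, List.append_nil, List.map_cons, List.map_map, List.cons_append]
    refine congrArg₂ _ (by push_cast; simp; ring) (congrArg₂ _ (by push_cast; ring) ?_)
    apply List.map_congr_left
    intro k _
    simp only [Function.comp, Nat.succ_eq_add_one]
    have : (k + 1 + 1) % 2 = k % 2 := by omega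
    rw [this]
    push_cast
    split_ifs <;> ring

theorem length_rotationC (n : ℕ) : (rotationC n).length = 4 * n + 4 := by
  rw [rotationC, List.flatMap_range_pair, List.flatMap_reverse_range_pair]
  simp
  ring

theorem getElem_rotationC (n p : ℕ) (hp : p < (rotationC n).length) :
    (rotationC n)[p] = if p < 2 * n + 2 then (p : ℤ) + 1 else if p = 2 * n + 2 then -2 else
      if p = 2 * n + 3 then -1 else
      if p % 2 = 0 then 4 * (n : ℤ) + 5 - p else 4 * (n : ℤ) + 7 - p := by
  have hp' := hp
  rw [length_rotationC] at hp'
  simp only [rotationC, List.flatMap_range_pair, List.flatMap_reverse_range_pair,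
    List.getElem_append, List.length_append, List.length_map, List.length_range,
    List.getElem_map, List.getElem_range, List.length_cons, List.length_nil]
  rcases lt_or_ge p 2 with h | h
  · rw [dif_pos (by omega), dif_pos (by omega), dif_pos (by omega), if_pos (by omega)]
    interval_cases p <;> rfl
  rcases lt_or_ge p (2 * n + 2) with h1 | h1
  · rw [dif_pos (by omega), dif_pos (by omega), dif_neg (by omega), if_pos h1]
    omega
  rcases lt_or_ge p (2 * n + 4) with h2 | h2
  · rw [dif_pos (by omega), dif_neg (by omega), if_neg (by omega)]
    obtain rfl | rfl : p = 2 * n + 2 ∨ p = 2 * n + 3 := by omega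
    · simp only [show 2 * n + 2 - (0 + 1 + 1 + 2 * n) = 0 by omega]
      simp
    · simp only [show 2 * n + 3 - (0 + 1 + 1 + 2 * n) = 1 by omega]
      simp
  · rw [dif_neg (by omega)]
    split_ifs <;> omega

/-! ### The flags of the bouquet and its three involutions. -/

theorem IsSignedRotation.partner_eq {w : List ℤ} (hw : IsSignedRotation w) {i j : Fin w.length}
    (hij : j ≠ i) (h : w[j].natAbs = w[i].natAbs) : hw.partner i = j :=
  (hw.existsUnique_partner i).unique ⟨hw.partner_ne i, hw.natAbs_partner i⟩ ⟨hij, h⟩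

theorem val_finRotate {N : ℕ} (i : Fin N) : (finRotate N i : ℕ) = (i + 1) % N := by
  rcases N with _ | N
  · exact i.elim0
  · rw [finRotate_apply, Fin.val_add]
    simp

/-- The flag of `C_{2n+2}` at the position `p`, read modulo the length of the rotation. -/
def flagC (n p : ℕ) (c : Bool) : Fin (rotationC n).length × Bool :=
  (⟨p % (4 * n + 4), by rw [length_rotationC]; exact Nat.mod_lt _ (by omega)⟩, c)

theorem exists_flagC_eq (n : ℕ) (x : Fin (rotationC n).length × Bool) :
    ∃ p < 4 * n + 4, x = flagC n p x.2 := by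
  have h : (x.1 : ℕ) < 4 * n + 4 := x.1.2.trans_eq (length_rotationC n)
  exact ⟨x.1, h, Prod.ext (Fin.ext (Nat.mod_eq_of_lt h).symm) rfl⟩

theorem flagC_add_length (n p : ℕ) (c : Bool) : flagC n (p + (4 * n + 4)) c = flagC n p c := by
  simp [flagC]

theorem bouquetC_t1_flagC_true (n p : ℕ) :
    (bouquetC n).t1 (flagC n p true) = flagC n (p + 1) false := by
  refine Prod.ext (Fin.ext ?_) rfl
  change (finRotate _ (flagC n p true).1 : ℕ) = _
  refine (val_finRotate _).trans ?_
  simp [flagC, length_rotationC]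

theorem bouquetC_t1_flagC_false (n p : ℕ) :
    (bouquetC n).t1 (flagC n (p + 1) false) = flagC n p true := by
  rw [← bouquetC_t1_flagC_true, (bouquetC n).t1_t1]

theorem bouquetC_t2_flagC (n p : ℕ) (c : Bool) :
    (bouquetC n).t2 (flagC n p c) = flagC n p (!c) := rfl

theorem bouquetC_t0_flagC_of_sign_eq {n p p' : ℕ} (c : Bool) (hp : p < (rotationC n).length)
    (hp' : p' < (rotationC n).length) (hne : p' ≠ p) (h : (rotationC n)[p'] = (rotationC n)[p]) :
    (bouquetC n).t0 (flagC n p c) = flagC n p' (!c) := by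
  have e : ∀ {p} (c) (hp : p < (rotationC n).length), flagC n p c = (⟨p, hp⟩, c) := fun c hp =>
    Prod.ext (Fin.ext (Nat.mod_eq_of_lt (by rwa [length_rotationC] at hp))) rfl
  have hpart : (isSignedRotation_rotationC n).partner ⟨p, hp⟩ = ⟨p', hp'⟩ :=
    IsSignedRotation.partner_eq _ (fun h => hne (Fin.ext_iff.1 h)) (congrArg Int.natAbs h)
  rw [e c hp, e _ hp']
  refine Prod.ext hpart (if_neg ?_)
  simp [IsSignedRotation.Twisted, hpart, h]

theorem bouquetC_t0_flagC_of_neg {n p p' : ℕ} (c : Bool) (hp : p < (rotationC n).length)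
    (hp' : p' < (rotationC n).length) (h : (rotationC n)[p'] = -(rotationC n)[p]) :
    (bouquetC n).t0 (flagC n p c) = flagC n p' c := by
  have e : ∀ {p} (c) (hp : p < (rotationC n).length), flagC n p c = (⟨p, hp⟩, c) := fun c hp =>
    Prod.ext (Fin.ext (Nat.mod_eq_of_lt (by rwa [length_rotationC] at hp))) rfl
  have h0 : (rotationC n)[p] ≠ 0 := fun h0 =>
    (isSignedRotation_rotationC n).1 (h0 ▸ List.getElem_mem hp)
  have hne : p' ≠ p := by
    rintro rfl
    omega
  have hpart : (isSignedRotation_rotationC n).partner ⟨p, hp⟩ = ⟨p', hp'⟩ :=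
    IsSignedRotation.partner_eq _ (fun h => hne (Fin.ext_iff.1 h))
      (by simp [h])
  rw [e c hp, e _ hp']
  refine Prod.ext hpart (if_pos ?_)
  simp only [IsSignedRotation.Twisted, hpart, Fin.getElem_fin, h, Int.sign_neg]
  intro hs
  have := Int.sign_eq_zero_iff_zero.1 (show (rotationC n)[p].sign = 0 by omega)
  exact h0 this

theorem bouquetC_t0_zero (n : ℕ) (c : Bool) :
    (bouquetC n).t0 (flagC n 0 c) = flagC n (2 * n + 3) c := by
  have h := length_rotationC n
  refine bouquetC_t0_flagC_of_neg c (by omega) (by omega) ?_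
  simp [getElem_rotationC]

theorem bouquetC_t0_one (n : ℕ) (c : Bool) :
    (bouquetC n).t0 (flagC n 1 c) = flagC n (2 * n + 2) c := by
  have h := length_rotationC n
  refine bouquetC_t0_flagC_of_neg c (by omega) (by omega) ?_
  simp [getElem_rotationC]

theorem bouquetC_t0_even {n i : ℕ} (hi : i < n) (c : Bool) :
    (bouquetC n).t0 (flagC n (2 * i + 2) c) = flagC n (4 * n + 2 - 2 * i) (!c) := by
  have h := length_rotationC n
  refine bouquetC_t0_flagC_of_sign_eq c (by omega) (by omega) (by omega) ?_
  rw [getElem_rotationC, getElem_rotationC, if_neg (by omega), if_neg (by omega),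
    if_neg (by omega), if_pos (by omega), if_pos (by omega)]
  omega

theorem bouquetC_t0_odd {n i : ℕ} (hi : i < n) (c : Bool) :
    (bouquetC n).t0 (flagC n (2 * i + 3) c) = flagC n (4 * n + 3 - 2 * i) (!c) := by
  have h := length_rotationC n
  refine bouquetC_t0_flagC_of_sign_eq c (by omega) (by omega) (by omega) ?_
  rw [getElem_rotationC, getElem_rotationC, if_neg (by omega), if_neg (by omega),
    if_neg (by omega), if_neg (by omega), if_pos (by omega)]
  omega

/-- Every flag lies at the first occurrence of an edge, or is mapped there by `t0`. -/
theorem exists_eq_flagC_or_t0_flagC (n : ℕ) (x : Fin (rotationC n).length × Bool) :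
    ∃ p < 2 * n + 2, ∃ c, x = flagC n p c ∨ x = (bouquetC n).t0 (flagC n p c) := by
  obtain ⟨p, hp, hx⟩ := exists_flagC_eq n x
  generalize x.2 = c at hx
  subst hx
  by_cases h : p < 2 * n + 2
  · exact ⟨p, h, c, .inl rfl⟩
  by_cases h2 : p = 2 * n + 2
  · exact ⟨1, by omega, c, .inr (by rw [bouquetC_t0_one, h2])⟩
  by_cases h3 : p = 2 * n + 3
  · exact ⟨0, by omega, c, .inr (by rw [bouquetC_t0_zero, h3])⟩
  rcases Nat.even_or_odd' p with ⟨k, rfl | rfl⟩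
  · refine ⟨2 * (2 * n + 1 - k) + 2, by omega, !c, .inr ?_⟩
    rw [bouquetC_t0_even (by omega), Bool.not_not]
    congr 1; omega
  · refine ⟨2 * (2 * n + 1 - k) + 3, by omega, !c, .inr ?_⟩
    rw [bouquetC_t0_odd (by omega), Bool.not_not]
    congr 1; omega

/-- Around the vertex, `t2` followed by `t1` changes colour twice, so all first corners share a
colour; the twisted loop `1` joins two first corners by `t0`. -/
theorem not_orientable_bouquetC (n : ℕ) : ¬ (bouquetC n).Orientable := by
  rintro ⟨f, hf⟩
  have hc : ∀ p, f (flagC n p false) = f (flagC n 0 false) := by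
    intro p
    induction p with
    | zero => rfl
    | succ p ih =>
      rw [← bouquetC_t1_flagC_true, (hf _).2.1, ← Bool.not_false, ← bouquetC_t2_flagC,
        (hf _).2.2, ih, Bool.not_not]
  have h := (hf (flagC n 0 false)).1
  rw [bouquetC_t0_zero, hc] at h
  simp at h

/-! ### Functions on flags translated into labellings of arcs. -/

/-- The edge `p + 1` of `C_{2n+2}`. -/
noncomputable def edgeC (n p : ℕ) : (bouquetC n).Edge := (bouquetC n).edgeOf (flagC n p false)

theorem edgeOf_flagC (n p : ℕ) (c : Bool) : (bouquetC n).edgeOf (flagC n p c) = edgeC n p := by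
  cases c
  · rfl
  · exact (bouquetC n).edgeOf_t2 (flagC n p false)

theorem edgeOf_t0_flagC (n p : ℕ) (c : Bool) :
    (bouquetC n).edgeOf ((bouquetC n).t0 (flagC n p c)) = edgeC n p := by
  rw [(bouquetC n).edgeOf_t0, edgeOf_flagC]

/-- A function on the flags that is constant along the sides of the ribbons in `A` and along the
ends of the other ribbons. -/
def IsConstOnRibbons {T : Type*} {n : ℕ} (A : Set (bouquetC n).Edge)
    (f : Fin (rotationC n).length × Bool → T) : Prop :=
  ∀ x, ((bouquetC n).edgeOf x ∈ A → f ((bouquetC n).t0 x) = f x) ∧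
    ((bouquetC n).edgeOf x ∉ A → f ((bouquetC n).t2 x) = f x)

section

variable {T : Type*} {n : ℕ} {A : Set (bouquetC n).Edge} {f : Fin (rotationC n).length × Bool → T}

/-- The four flags of an edge are the two at its first occurrence and their images under `t0`, so
one condition per edge suffices. -/
theorem isConstOnRibbons_iff :
    IsConstOnRibbons A f ↔ ∀ p < 2 * n + 2,
      (edgeC n p ∈ A → ∀ c, f ((bouquetC n).t0 (flagC n p c)) = f (flagC n p c)) ∧
      (edgeC n p ∉ A → f (flagC n p true) = f (flagC n p false) ∧
        f ((bouquetC n).t0 (flagC n p true)) = f ((bouquetC n).t0 (flagC n p false))) := by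
  constructor
  · intro h p _
    refine ⟨fun hA c => (h _).1 (by rwa [edgeOf_flagC]), fun hA => ⟨?_, ?_⟩⟩
    · exact (h (flagC n p false)).2 (by rwa [edgeOf_flagC])
    · have := (h ((bouquetC n).t0 (flagC n p false))).2 (by rwa [edgeOf_t0_flagC])
      rwa [← (bouquetC n).t0_t2] at this
  · intro h x
    obtain ⟨p, hp, c, rfl | rfl⟩ := exists_eq_flagC_or_t0_flagC n x
    · rw [edgeOf_flagC, bouquetC_t2_flagC]
      refine ⟨fun hA => (h p hp).1 hA c, fun hA => ?_⟩
      cases c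
      · exact ((h p hp).2 hA).1
      · exact ((h p hp).2 hA).1.symm
    · rw [edgeOf_t0_flagC, (bouquetC n).t0_t0, ← (bouquetC n).t0_t2, bouquetC_t2_flagC]
      refine ⟨fun hA => ((h p hp).1 hA c).symm, fun hA => ?_⟩
      cases c
      · exact ((h p hp).2 hA).2
      · exact ((h p hp).2 hA).2.symm

/-- The value of `f` on the arc of the vertex boundary that follows the position `p`. -/
def arcValue (f : Fin (rotationC n).length × Bool → T) (p : ℕ) : T := f (flagC n p true)

/-- The arc between the two edges of the `i`-th pair on the right. -/
def rightArc (n i : ℕ) : ℕ := if i = 0 then 2 * n + 2 else 4 * n + 4 - 2 * i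

theorem isConstOnRibbons_iff_isGapLabelling
    (h1 : ∀ p, f (flagC n (p + 1) false) = f (flagC n p true)) :
    IsConstOnRibbons A f ↔
      IsGapLabelling n (fun i => edgeC n (2 * i) ∈ A) (fun i => edgeC n (2 * i + 1) ∈ A)
        (fun i => arcValue f (2 * i + 1)) (fun i => arcValue f (4 * n + 3 - 2 * i))
        (fun i => arcValue f (2 * i)) (fun i => arcValue f (rightArc n i)) := by
  -- The arc `R 0` runs across the starting point of the cyclic word.
  have hz : f (flagC n 0 false) = f (flagC n (4 * n + 3) true) := by
    rw [← h1, ← flagC_add_length n 0]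
    congr 2; omega
  have hr : ∀ i < n, f (flagC n (4 * n + 2 - 2 * i) false) =
      f (flagC n (4 * n + 3 - 2 * (i + 1)) true) := fun i hi => by
    rw [← h1]; congr 2; omega
  have hr' : ∀ i < n, f (flagC n (4 * n + 3 - 2 * i) false) =
      f (flagC n (4 * n + 4 - 2 * (i + 1)) true) := fun i hi => by
    rw [← h1]; congr 2; omega
  have e2 : ∀ i, 4 * n + 4 - 2 * (i + 1) = 4 * n + 2 - 2 * i := fun i => by omega
  have e3 : 4 * n + 3 - 2 * n = 2 * n + 3 := by omega
  rw [isConstOnRibbons_iff]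
  constructor
  · intro h
    constructor
    · intro i hi ha
      obtain ⟨k1, k2⟩ := (h (2 * i + 2) (by omega)).2 ha
      rw [bouquetC_t0_even hi, bouquetC_t0_even hi] at k2
      simp only [Bool.not_true, Bool.not_false] at k2
      rw [h1] at k1
      rw [hr i hi] at k2
      simp only [arcValue, rightArc, e2, Nat.add_eq_zero_iff, one_ne_zero, and_false, if_false]
      exact ⟨k1, k2.symm⟩
    · intro i hi ha
      have k := (h (2 * i + 2) (by omega)).1 ha
      simp only [bouquetC_t0_even hi] at k
      have k1 := k true
      have k2 := k false
      simp only [Bool.not_true, Bool.not_false] at k1 k2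
      rw [h1] at k2
      rw [hr i hi] at k1
      simp only [arcValue, rightArc, e2, Nat.add_eq_zero_iff, one_ne_zero, and_false, if_false]
      exact ⟨k1.symm, k2⟩
    · intro i hi ha
      obtain ⟨k1, k2⟩ := (h (2 * i + 3) (by omega)).2 ha
      rw [bouquetC_t0_odd hi, bouquetC_t0_odd hi] at k2
      simp only [Bool.not_true, Bool.not_false] at k2
      rw [h1] at k1
      rw [hr' i hi] at k2
      simp only [arcValue, rightArc, Nat.add_eq_zero_iff, one_ne_zero, and_false, if_false]
      exact ⟨k1, k2.symm⟩
    · intro i hi ha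
      have k := (h (2 * i + 3) (by omega)).1 ha
      simp only [bouquetC_t0_odd hi] at k
      have k1 := k true
      have k2 := k false
      simp only [Bool.not_true, Bool.not_false] at k1 k2
      rw [h1] at k2
      rw [hr' i hi] at k1
      simp only [arcValue, rightArc, Nat.add_eq_zero_iff, one_ne_zero, and_false, if_false]
      exact ⟨k1.symm, k2⟩
    · intro ha
      obtain ⟨k1, k2⟩ := (h 0 (by omega)).2 ha
      rw [bouquetC_t0_zero, bouquetC_t0_zero, h1] at k2
      rw [hz] at k1
      simp only [arcValue, rightArc, e3, if_true]
      exact ⟨k1, k2.symm⟩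
    · intro ha
      have k := (h 0 (by omega)).1 ha
      simp only [bouquetC_t0_zero] at k
      have k1 := k true
      have k2 := k false
      rw [h1, hz] at k2
      simp only [arcValue, rightArc, e3, if_true]
      exact ⟨k1.symm, k2⟩
    · intro ha
      obtain ⟨k1, k2⟩ := (h 1 (by omega)).2 ha
      rw [bouquetC_t0_one, bouquetC_t0_one, h1] at k2
      rw [h1 0] at k1
      simp only [arcValue, rightArc, if_true]
      exact ⟨k1, k2.symm⟩
    · intro ha
      have k := (h 1 (by omega)).1 ha
      simp only [bouquetC_t0_one] at k
      have k1 := k true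
      have k2 := k false
      rw [h1, h1 0] at k2
      simp only [arcValue, rightArc, if_true]
      exact ⟨k1.symm, k2⟩
  · intro h p hp
    obtain ⟨g1, g2, g3, g4, g5, g6, g7, g8⟩ := h
    simp only [arcValue, rightArc, e2, e3, if_true, Nat.add_eq_zero_iff, one_ne_zero, and_false,
      if_false] at g1 g2 g3 g4 g5 g6 g7 g8
    rcases Nat.lt_or_ge p 2 with h2 | h2
    · interval_cases p
      · simp only [bouquetC_t0_zero, Bool.forall_bool, hz, h1]
        exact ⟨fun ha => ⟨(g6 ha).2, (g6 ha).1.symm⟩, fun ha => ⟨(g5 ha).1, (g5 ha).2.symm⟩⟩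
      · simp only [bouquetC_t0_one, Bool.forall_bool, h1 0, h1]
        exact ⟨fun ha => ⟨(g8 ha).2, (g8 ha).1.symm⟩, fun ha => ⟨(g7 ha).1, (g7 ha).2.symm⟩⟩
    · obtain ⟨i, rfl | rfl⟩ : ∃ i, p = 2 * i + 2 ∨ p = 2 * i + 3 := ⟨(p - 2) / 2, by omega⟩
      · have hi : i < n := by omega
        simp only [bouquetC_t0_even hi, Bool.forall_bool, Bool.not_true, Bool.not_false, hr i hi,
          h1]
        exact ⟨fun ha => ⟨(g2 i hi ha).2, (g2 i hi ha).1.symm⟩,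
          fun ha => ⟨(g1 i hi ha).1, (g1 i hi ha).2.symm⟩⟩
      · have hi : i < n := by omega
        simp only [bouquetC_t0_odd hi, Bool.forall_bool, Bool.not_true, Bool.not_false, hr' i hi,
          h1, e2]
        exact ⟨fun ha => ⟨(g4 i hi ha).2, (g4 i hi ha).1.symm⟩,
          fun ha => ⟨(g3 i hi ha).1, (g3 i hi ha).2.symm⟩⟩

/-- Every arc is one of the arcs `L i`, `R i`, `U i`, `V i`. -/
theorem exists_arc_eq {p : ℕ} (hp : p < 4 * n + 4) :
    ∃ i ≤ n, p = 2 * i + 1 ∨ p = 4 * n + 3 - 2 * i ∨ p = 2 * i ∨ p = rightArc n i := by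
  by_cases h2 : p = 2 * n + 2
  · exact ⟨0, by omega, by simp [rightArc, h2]⟩
  rcases Nat.even_or_odd' p with ⟨k, rfl | rfl⟩
  · by_cases hk : k ≤ n
    · exact ⟨k, hk, by simp⟩
    · refine ⟨2 * n + 2 - k, by omega, .inr (.inr (.inr ?_))⟩
      rw [rightArc, if_neg (by omega)]
      omega
  · by_cases hk : k ≤ n
    · exact ⟨k, hk, by simp⟩
    · exact ⟨2 * n + 1 - k, by omega, by omega⟩

/-- A function on the arcs with prescribed values on `L i`, `R i`, `U i` and `V i`. -/
def arcGlue (n : ℕ) (L R U V : ℕ → T) (p : ℕ) : T :=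
  if p % 2 = 0 then
    if p ≤ 2 * n then U (p / 2) else if p = 2 * n + 2 then V 0 else V ((4 * n + 4 - p) / 2)
  else if p ≤ 2 * n + 1 then L (p / 2) else R ((4 * n + 3 - p) / 2)

theorem exists_arcValue_eq (L R U V : ℕ → T) :
    ∃ f : Fin (rotationC n).length × Bool → T,
      (∀ p, f (flagC n (p + 1) false) = f (flagC n p true)) ∧
      (∀ i ≤ n, arcValue f (2 * i + 1) = L i) ∧ (∀ i ≤ n, arcValue f (4 * n + 3 - 2 * i) = R i) ∧
      (∀ i ≤ n, arcValue f (2 * i) = U i) ∧ (∀ i ≤ n, arcValue f (rightArc n i) = V i) := by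
  set g := arcGlue n L R U V with hg
  -- A first corner lies on the arc after the preceding position; adding `4n+3` subtracts `1` modulo
  -- the length.
  refine ⟨fun x => if x.2 then g x.1 else g ((x.1 + (4 * n + 3)) % (4 * n + 4)), ?_, ?_, ?_, ?_, ?_⟩
  · intro p
    simp only [flagC, Bool.false_eq_true, if_false, if_true]
    congr 1
    rw [Nat.mod_add_mod, show p + 1 + (4 * n + 3) = p + (4 * n + 4) by ring, Nat.add_mod_right]
  all_goals
    intro i hi
    simp only [arcValue, flagC, if_true]
  · rw [Nat.mod_eq_of_lt (by omega), hg, arcGlue, if_neg (by omega), if_pos (by omega)]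
    congr 1; omega
  · rw [Nat.mod_eq_of_lt (by omega), hg, arcGlue, if_neg (by omega),
      if_neg (by omega)]
    congr 1; omega
  · rw [Nat.mod_eq_of_lt (by omega), hg, arcGlue, if_pos (by omega), if_pos (by omega)]
    congr 1; omega
  · rcases Nat.eq_zero_or_pos i with rfl | hi0
    · simp only [rightArc, if_true]
      rw [Nat.mod_eq_of_lt (by omega), hg, arcGlue, if_pos (by omega), if_neg (by omega),
        if_pos rfl]
    · rw [rightArc, if_neg (by omega), Nat.mod_eq_of_lt (by omega), hg, arcGlue,
        if_pos (by omega), if_neg (by omega), if_neg (by omega)]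
      congr 1; omega

end

/-- The equations involve only indices up to `n`, and arcs carry prescribed values only there. -/
theorem IsGapLabelling.congr {T : Type*} {n : ℕ} {a b : ℕ → Prop} {L R U V L' R' U' V' : ℕ → T}
    (h : IsGapLabelling n a b L R U V) (hL : ∀ i ≤ n, L' i = L i) (hR : ∀ i ≤ n, R' i = R i)
    (hU : ∀ i ≤ n, U' i = U i) (hV : ∀ i ≤ n, V' i = V i) :
    IsGapLabelling n a b L' R' U' V' := by
  obtain ⟨g1, g2, g3, g4, g5, g6, g7, g8⟩ := h
  have h0 := Nat.zero_le n
  constructor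
  · intro i hi; rw [hU _ hi, hV _ hi, hL _ hi.le, hR _ hi]; exact g1 i hi
  · intro i hi; rw [hU _ hi, hV _ hi, hL _ hi.le, hR _ hi]; exact g2 i hi
  · intro i hi; rw [hU _ hi, hV _ hi, hL _ hi, hR _ hi.le]; exact g3 i hi
  · intro i hi; rw [hU _ hi, hV _ hi, hL _ hi, hR _ hi.le]; exact g4 i hi
  · rwa [hU _ h0, hV _ h0, hR _ h0, hR _ le_rfl]
  · rwa [hU _ h0, hV _ h0, hR _ h0, hR _ le_rfl]
  · rwa [hU _ h0, hV _ h0, hL _ h0, hL _ le_rfl]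
  · rwa [hU _ h0, hV _ h0, hL _ h0, hL _ le_rfl]

/-! ### Faces and edges of partial duals. -/

namespace RibbonGraph

variable {F : Type*} (G : RibbonGraph F) (A : Set G.Edge)

theorem partialDual_t2_of_mem {x : F} (h : G.edgeOf x ∈ A) : (G.partialDual A).t2 x = G.t0 x :=
  if_pos h

theorem partialDual_t2_of_notMem {x : F} (h : G.edgeOf x ∉ A) :
    (G.partialDual A).t2 x = G.t2 x :=
  if_neg h

theorem partialDual_t0_of_mem {x : F} (h : G.edgeOf x ∈ A) : (G.partialDual A).t0 x = G.t2 x :=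
  if_pos h

theorem partialDual_t0_of_notMem {x : F} (h : G.edgeOf x ∉ A) :
    (G.partialDual A).t0 x = G.t0 x :=
  if_neg h

theorem partialDual_compl_t2 (x : F) : (G.partialDual Aᶜ).t2 x = (G.partialDual A).t0 x := by
  by_cases h : G.edgeOf x ∈ A
  · rw [partialDual_t0_of_mem _ _ h, partialDual_t2_of_notMem _ _ (by simpa using h)]
  · rw [partialDual_t0_of_notMem _ _ h, partialDual_t2_of_mem _ _ (by simpa using h)]

/-- Complementing `A` exchanges `t0` and `t2` of the dual, so faces need no separate count. -/
theorem card_face_partialDual :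
    Nat.card (G.partialDual A).Face = Nat.card (G.partialDual Aᶜ).Vertex := by
  refine Nat.card_congr (Quot.congrRight fun x y => ?_)
  rw [partialDual_compl_t2]
  exact or_comm

theorem card_edge_partialDual : Nat.card (G.partialDual A).Edge = Nat.card G.Edge := by
  refine Nat.card_congr (Quot.congrRight fun x y => ?_)
  by_cases h : G.edgeOf x ∈ A
  · rw [partialDual_t0_of_mem _ _ h, partialDual_t2_of_mem _ _ h]
    exact or_comm
  · rw [partialDual_t0_of_notMem _ _ h, partialDual_t2_of_notMem _ _ h]

end RibbonGraph

/-! ### Vertices, components and Euler genus of the partial duals. -/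

section

variable {n : ℕ}

theorem exists_eq_arcValue {T : Type*} {f : Fin (rotationC n).length × Bool → T}
    (h1 : ∀ p, f (flagC n (p + 1) false) = f (flagC n p true))
    (x : Fin (rotationC n).length × Bool) :
    ∃ i ≤ n, f x = arcValue f (2 * i + 1) ∨ f x = arcValue f (4 * n + 3 - 2 * i) ∨
      f x = arcValue f (2 * i) ∨ f x = arcValue f (rightArc n i) := by
  obtain ⟨p, hp, hx⟩ : ∃ p < 4 * n + 4, f x = arcValue f p := by
    obtain ⟨p, hp, hx⟩ := exists_flagC_eq n x
    generalize x.2 = c at hx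
    subst hx
    cases c
    · rcases p with _ | p
      · refine ⟨4 * n + 3, by omega, ?_⟩
        rw [← flagC_add_length, show 0 + (4 * n + 4) = 4 * n + 3 + 1 by ring, h1]
        rfl
      · exact ⟨p, by omega, h1 p⟩
    · exact ⟨p, hp, rfl⟩
  obtain ⟨i, hi, h⟩ := exists_arc_eq hp
  rw [hx]
  exact ⟨i, hi, h.imp (congrArg _) (Or.imp (congrArg _) (Or.imp (congrArg _) (congrArg _)))⟩

theorem vertex_mk_t1 (A : Set (bouquetC n).Edge) (x : Fin (rotationC n).length × Bool) :
    (Quot.mk _ ((bouquetC n).t1 x) : ((bouquetC n).partialDual A).Vertex) = Quot.mk _ x :=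
  (Quot.sound (.inl rfl)).symm

theorem isConstOnRibbons_vertex_mk (A : Set (bouquetC n).Edge) :
    IsConstOnRibbons A (fun x => (Quot.mk _ x : ((bouquetC n).partialDual A).Vertex)) := by
  refine fun x => ⟨fun h => (Quot.sound (.inr ?_)).symm, fun h => (Quot.sound (.inr ?_)).symm⟩
  · exact (RibbonGraph.partialDual_t2_of_mem _ _ h).symm
  · exact (RibbonGraph.partialDual_t2_of_notMem _ _ h).symm

theorem exists_vertex_lift {T : Type*} {A : Set (bouquetC n).Edge}
    {f : Fin (rotationC n).length × Bool → T}
    (h1 : ∀ p, f (flagC n (p + 1) false) = f (flagC n p true)) (h : IsConstOnRibbons A f) :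
    ∃ F : ((bouquetC n).partialDual A).Vertex → T, ∀ x, F (Quot.mk _ x) = f x := by
  refine ⟨Quot.lift f ?_, fun x => rfl⟩
  rintro x y (rfl | rfl)
  · change f x = f ((bouquetC n).t1 x)
    obtain ⟨p, hp, hx⟩ := exists_flagC_eq n x
    generalize x.2 = c at hx
    subst hx
    cases c
    · rw [← flagC_add_length, show p + (4 * n + 4) = p + (4 * n + 3) + 1 by ring,
        bouquetC_t1_flagC_false, h1]
    · rw [bouquetC_t1_flagC_true, h1]
  · by_cases hA : (bouquetC n).edgeOf x ∈ A
    · rw [RibbonGraph.partialDual_t2_of_mem _ _ hA, (h x).1 hA]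
    · rw [RibbonGraph.partialDual_t2_of_notMem _ _ hA, (h x).2 hA]

open Classical in
-- The quotient map from flags to vertices gives the universal labelling: any labelling by naturals
-- extends to the flags and descends to the vertices.
theorem card_vertex_partialDual_bouquetC (A : Set (bouquetC n).Edge) {s : ℕ}
    (hs : s = singleCount (fun i => edgeC n (2 * i) ∈ A) (fun i => edgeC n (2 * i + 1) ∈ A) n) :
    Nat.card ((bouquetC n).partialDual A).Vertex =
      if edgeC n 0 ∈ A ↔ edgeC n 1 ∈ A then s + 1 else max s 1 := by
  have h1 : ∀ p, (Quot.mk _ (flagC n (p + 1) false) : ((bouquetC n).partialDual A).Vertex) =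
      Quot.mk _ (flagC n p true) := fun p => by
    rw [← bouquetC_t1_flagC_true, vertex_mk_t1]
  have h := (isConstOnRibbons_iff_isGapLabelling h1).1 (isConstOnRibbons_vertex_mk A)
  rw [hs]
  refine h.card_of_universal ?_ ?_
  · intro q
    obtain ⟨x, rfl⟩ := Quot.exists_rep q
    exact exists_eq_arcValue h1 x
  · intro L' R' U' V' h'
    obtain ⟨f, hf1, hL, hR, hU, hV⟩ := exists_arcValue_eq (n := n) L' R' U' V'
    have hf := (isConstOnRibbons_iff_isGapLabelling (A := A) hf1).2 (h'.congr hL hR hU hV)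
    obtain ⟨g, hg⟩ := exists_vertex_lift hf1 hf
    exact ⟨g, fun i hi => (hg _).trans (hL i hi)⟩

/-- Both `t1` and `t2` of the bouquet act within components of the dual, and they already connect
all flags around the single vertex. -/
theorem card_component_partialDual_bouquetC (A : Set (bouquetC n).Edge) :
    Nat.card ((bouquetC n).partialDual A).Component = 1 := by
  set q : Fin (rotationC n).length × Bool → ((bouquetC n).partialDual A).Component :=
    Quot.mk _
  have h2 : ∀ x, q ((bouquetC n).t2 x) = q x := by
    intro x
    by_cases hA : (bouquetC n).edgeOf x ∈ A
    · exact (Quot.sound (.inl ((RibbonGraph.partialDual_t0_of_mem _ _ hA).symm))).symm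
    · exact (Quot.sound (.inr (.inr ((RibbonGraph.partialDual_t2_of_notMem _ _ hA).symm)))).symm
  have h1 : ∀ x, q ((bouquetC n).t1 x) = q x := fun x => (Quot.sound (.inr (.inl rfl))).symm
  have hf : ∀ p, q (flagC n p false) = q (flagC n 0 false) := by
    intro p
    induction p with
    | zero => rfl
    | succ p ih =>
      rw [← bouquetC_t1_flagC_true, h1, ← ih, ← h2, bouquetC_t2_flagC, Bool.not_true]
  rw [Nat.card_eq_one_iff_exists]
  refine ⟨q (flagC n 0 false), fun y => ?_⟩
  obtain ⟨x, rfl⟩ := Quot.exists_rep y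
  change q x = _
  obtain ⟨p, hp, hx⟩ := exists_flagC_eq n x
  rw [hx, ← hf p]
  cases x.2
  · rfl
  · exact h2 (flagC n p false)

theorem edgeC_bijective (n : ℕ) :
    Function.Bijective fun p : Fin (2 * n + 2) => edgeC n p := by
  constructor
  · let lab : (bouquetC n).Edge → ℕ := Quot.lift (fun x => ((rotationC n)[x.1]).natAbs) (by
      rintro x y (rfl | rfl)
      · exact ((isSignedRotation_rotationC n).natAbs_partner x.1).symm
      · rfl)
    have hlab : ∀ p : Fin (2 * n + 2), lab (edgeC n p) = p + 1 := by
      intro p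
      refine (congrArg Int.natAbs (getElem_rotationC n (p % (4 * n + 4)) _)).trans ?_
      rw [Nat.mod_eq_of_lt (by omega), if_pos (by omega)]
      omega
    intro p p' h
    have := congrArg lab h
    simp only [hlab] at this
    omega
  · intro e
    obtain ⟨x, rfl⟩ := Quot.exists_rep e
    change ∃ p : Fin (2 * n + 2), _ = (bouquetC n).edgeOf x
    obtain ⟨p, hp, c, rfl | rfl⟩ := exists_eq_flagC_or_t0_flagC n x
    · exact ⟨⟨p, hp⟩, (edgeOf_flagC n p c).symm⟩
    · exact ⟨⟨p, hp⟩, (edgeOf_t0_flagC n p c).symm⟩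

theorem card_edge_bouquetC (n : ℕ) : Nat.card (bouquetC n).Edge = 2 * n + 2 := by
  rw [← Nat.card_congr (Equiv.ofBijective _ (edgeC_bijective n)), Nat.card_fin]

open Classical in
theorem eulerGenus_partialDual_bouquetC (A : Set (bouquetC n).Edge) {s : ℕ}
    (hs : s = singleCount (fun i => edgeC n (2 * i) ∈ A) (fun i => edgeC n (2 * i + 1) ∈ A) n) :
    ((bouquetC n).partialDual A).eulerGenus = 2 * n + 4 -
      2 * if edgeC n 0 ∈ A ↔ edgeC n 1 ∈ A then s + 1 else max s 1 := by
  have hc : s = singleCount (fun i => edgeC n (2 * i) ∈ Aᶜ)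
      (fun i => edgeC n (2 * i + 1) ∈ Aᶜ) n := by
    simp only [hs, singleCount, Set.mem_compl_iff, not_iff_not]
  rw [RibbonGraph.eulerGenus, RibbonGraph.card_face_partialDual,
    RibbonGraph.card_edge_partialDual, card_component_partialDual_bouquetC, card_edge_bouquetC,
    card_vertex_partialDual_bouquetC A hs, card_vertex_partialDual_bouquetC Aᶜ hc]
  simp only [Set.mem_compl_iff, not_iff_not]
  -- No bound on `s` is required: `Int.toNat` and subtraction in `ℕ` truncate alike.
  split_ifs <;> push_cast <;> omega

end

/-! ### Edge sets parametrised by first edges and singles. -/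

/-- The indicator of `D ⊆ {1, …, n}`, extended by the value `z` at `0`. -/
def singleIndicator {n : ℕ} (z : Bool) (D : Finset (Fin n)) : Fin (n + 1) → Bool :=
  Fin.cons z fun i => decide (i ∈ D)

/-- The set of edges of `C_{2n+2}` in which `u` marks the pairs whose first edge is present and
`z` and `D` mark the pairs of which exactly one edge is present. -/
def edgeSetC (n : ℕ) (t : (Fin (n + 1) → Bool) × Bool × Finset (Fin n)) :
    Set (bouquetC n).Edge :=
  {e | ∃ j : Fin (n + 1), (e = edgeC n (2 * j) ∧ t.1 j = true) ∨
    (e = edgeC n (2 * j + 1) ∧ (t.1 j ^^ singleIndicator t.2.1 t.2.2 j) = true)}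

theorem edgeC_inj {n p p' : ℕ} (hp : p < 2 * n + 2) (hp' : p' < 2 * n + 2) :
    edgeC n p = edgeC n p' ↔ p = p' :=
  ⟨fun h => Fin.ext_iff.1 (@(edgeC_bijective n).1 ⟨p, hp⟩ ⟨p', hp'⟩ h), fun h => h ▸ rfl⟩

theorem edgeC_even_mem_edgeSetC {n : ℕ} (t : (Fin (n + 1) → Bool) × Bool × Finset (Fin n))
    (j : Fin (n + 1)) : edgeC n (2 * j) ∈ edgeSetC n t ↔ t.1 j = true := by
  refine ⟨?_, fun h => ⟨j, .inl ⟨rfl, h⟩⟩⟩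
  rintro ⟨k, ⟨h, hk⟩ | ⟨h, -⟩⟩
  · rw [edgeC_inj (by omega) (by omega)] at h
    rwa [show j = k by omega]
  · rw [edgeC_inj (by omega) (by omega)] at h
    omega

theorem edgeC_odd_mem_edgeSetC {n : ℕ} (t : (Fin (n + 1) → Bool) × Bool × Finset (Fin n))
    (j : Fin (n + 1)) : edgeC n (2 * j + 1) ∈ edgeSetC n t ↔
      (t.1 j ^^ singleIndicator t.2.1 t.2.2 j) = true := by
  refine ⟨?_, fun h => ⟨j, .inr ⟨rfl, h⟩⟩⟩
  rintro ⟨k, ⟨h, -⟩ | ⟨h, hk⟩⟩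
  · rw [edgeC_inj (by omega) (by omega)] at h
    omega
  · rw [edgeC_inj (by omega) (by omega)] at h
    rwa [show j = k by omega]

theorem edgeSetC_iff {n : ℕ} (t : (Fin (n + 1) → Bool) × Bool × Finset (Fin n))
    (j : Fin (n + 1)) : (edgeC n (2 * j) ∈ edgeSetC n t ↔ edgeC n (2 * j + 1) ∈ edgeSetC n t) ↔
      singleIndicator t.2.1 t.2.2 j = false := by
  rw [edgeC_even_mem_edgeSetC, edgeC_odd_mem_edgeSetC]
  cases t.1 j <;> cases singleIndicator t.2.1 t.2.2 j <;> simp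

theorem edgeSetC_bijective (n : ℕ) : Function.Bijective (edgeSetC n) := by
  classical
  constructor
  · intro t t' h
    have hu : t.1 = t'.1 := by
      ext j
      rw [Bool.eq_iff_iff, ← edgeC_even_mem_edgeSetC, ← edgeC_even_mem_edgeSetC, h]
    have hd : ∀ j, singleIndicator t.2.1 t.2.2 j = singleIndicator t'.2.1 t'.2.2 j := by
      intro j
      have h1 := edgeSetC_iff t j
      rw [h, edgeSetC_iff t' j] at h1
      revert h1
      cases singleIndicator t.2.1 t.2.2 j <;> cases singleIndicator t'.2.1 t'.2.2 j <;> simp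
    refine Prod.ext hu (Prod.ext (hd 0) (Finset.ext fun i => ?_))
    simpa [singleIndicator] using hd i.succ
  · intro A
    let d : Fin (n + 1) → Bool := fun j =>
      decide (edgeC n (2 * j) ∈ A) ^^ decide (edgeC n (2 * j + 1) ∈ A)
    let t : (Fin (n + 1) → Bool) × Bool × Finset (Fin n) :=
      (fun j => decide (edgeC n (2 * j) ∈ A), d 0, Finset.univ.filter fun i => d i.succ = true)
    have hd : singleIndicator t.2.1 t.2.2 = d := by
      funext j
      refine Fin.cases rfl (fun i => ?_) j
      simp [singleIndicator, t]
    refine ⟨t, Set.ext fun e => ?_⟩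
    obtain ⟨p, rfl⟩ := (edgeC_bijective n).2 e
    obtain ⟨j, hj⟩ : ∃ j : Fin (n + 1), (p : ℕ) = 2 * j ∨ (p : ℕ) = 2 * j + 1 :=
      ⟨⟨p / 2, by omega⟩, by dsimp only; omega⟩
    dsimp only
    rcases hj with hj | hj
    · rw [hj, edgeC_even_mem_edgeSetC]
      simp [t]
    · rw [hj, edgeC_odd_mem_edgeSetC, hd]
      simp [t, d]

theorem singleCount_edgeSetC {n : ℕ} (t : (Fin (n + 1) → Bool) × Bool × Finset (Fin n)) :
    singleCount (fun i => edgeC n (2 * i) ∈ edgeSetC n t)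
      (fun i => edgeC n (2 * i + 1) ∈ edgeSetC n t) n = t.2.2.card := by
  classical
  rw [singleCount, Finset.sum_range, ← Finset.filter_univ_mem t.2.2, Finset.card_filter]
  refine Finset.sum_congr rfl fun i _ => ?_
  have h := edgeSetC_iff t i.succ
  simp only [Fin.val_succ, singleIndicator, Fin.cons_succ, decide_eq_false_iff_not] at h
  simp only [h, ite_not]

theorem eulerGenus_partialDual_edgeSetC {n : ℕ}
    (t : (Fin (n + 1) → Bool) × Bool × Finset (Fin n)) :
    ((bouquetC n).partialDual (edgeSetC n t)).eulerGenus =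
      2 * n + 4 - 2 * if t.2.1 then max t.2.2.card 1 else t.2.2.card + 1 := by
  rw [eulerGenus_partialDual_bouquetC _ (singleCount_edgeSetC t).symm]
  have h := edgeSetC_iff t 0
  simp only [Fin.val_zero, mul_zero, zero_add, singleIndicator, Fin.cons_zero] at h
  simp only [h]
  cases t.2.1 <;> simp

/-! ### Summation and the gap in the exponents. -/

theorem Finset.sum_univ_apply_card {α : Type*} [AddCommMonoid α] (n : ℕ) (f : ℕ → α) :
    ∑ D : Finset (Fin n), f D.card = ∑ m ∈ Finset.range (n + 1), n.choose m • f m := by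
  rw [← Finset.powerset_univ, Finset.sum_powerset_apply_card, Finset.card_univ, Fintype.card_fin]

theorem partialDualEulerGenusPoly_bouquetC (n : ℕ) :
    (bouquetC n).partialDualEulerGenusPoly = 2 ^ (n + 1) *
      (∑ m ∈ Finset.range (n + 1), n.choose m • (X : ℤ[X]) ^ (2 * n + 4 - 2 * max m 1) +
        ∑ m ∈ Finset.range (n + 1), n.choose m • (X : ℤ[X]) ^ (2 * n + 4 - 2 * (m + 1))) := by
  rw [RibbonGraph.partialDualEulerGenusPoly, ← finsum_eq_of_bijective (edgeSetC n)
    (edgeSetC_bijective n) (fun t => rfl), finsum_eq_sum_of_fintype]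
  simp only [eulerGenus_partialDual_edgeSetC, Fintype.sum_prod_type, Fintype.sum_bool, if_true,
    Bool.false_eq_true, if_false]
  rw [Finset.sum_univ_apply_card n fun m => (X : ℤ[X]) ^ (2 * n + 4 - 2 * max m 1),
    Finset.sum_univ_apply_card n fun m => (X : ℤ[X]) ^ (2 * n + 4 - 2 * (m + 1))]
  simp [mul_add]

/-- The top coefficient `n + 2` collects `m = 0, 1` of the first sum and `m = 0` of the second; `X ^
2` is the term `m = n` of the second, distinct from `m = 0` because `n ≥ 1`. -/
theorem sum_choose_eq (n : ℕ) (hn : 1 ≤ n) :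
    ∑ m ∈ Finset.range (n + 1), n.choose m • (X : ℤ[X]) ^ (2 * n + 4 - 2 * max m 1) +
        ∑ m ∈ Finset.range (n + 1), n.choose m • (X : ℤ[X]) ^ (2 * n + 4 - 2 * (m + 1)) =
      ((n : ℤ[X]) + 2) * X ^ (2 * n + 2) + ∑ s ∈ Finset.Icc 2 n,
        ((n.choose s : ℤ[X]) + (n.choose (s - 1) : ℤ[X])) * X ^ (2 * n - 2 * s + 4) + X ^ 2 := by
  obtain ⟨k, rfl⟩ : ∃ k, n = k + 1 := ⟨n - 1, by omega⟩
  have hI : ∀ f : ℕ → ℤ[X], ∑ s ∈ Finset.Icc 2 (k + 1), f s = ∑ m ∈ Finset.range k, f (m + 2) := by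
    intro f
    rw [← Finset.Ico_add_one_right_eq_Icc, Finset.sum_Ico_eq_sum_range]
    exact Finset.sum_congr (by congr 1) fun m _ => by rw [add_comm]
  have h1 : ∀ m ∈ Finset.range k, (k + 1).choose (m + 1 + 1) •
      (X : ℤ[X]) ^ (2 * (k + 1) + 4 - 2 * max (m + 1 + 1) 1) =
        ((k + 1).choose (m + 2) : ℤ[X]) * X ^ (2 * (k + 1) - 2 * (m + 2) + 4) := by
    intro m hm
    rw [Finset.mem_range] at hm
    rw [nsmul_eq_mul]
    congr 2
    omega
  have h2 : ∀ m ∈ Finset.range k, (k + 1).choose (m + 1) •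
      (X : ℤ[X]) ^ (2 * (k + 1) + 4 - 2 * (m + 1 + 1)) =
        ((k + 1).choose (m + 2 - 1) : ℤ[X]) * X ^ (2 * (k + 1) - 2 * (m + 2) + 4) := by
    intro m hm
    rw [Finset.mem_range] at hm
    rw [nsmul_eq_mul]
    congr 2
    omega
  rw [hI, Finset.sum_range_succ', Finset.sum_range_succ', Finset.sum_congr rfl h1,
    Finset.sum_range_succ _ (k + 1), Finset.sum_range_succ' _ k, Finset.sum_congr rfl h2]
  simp only [add_mul, Finset.sum_add_distrib]
  have e1 : 2 * (k + 1) + 4 - 2 * max (0 + 1) 1 = 2 * (k + 1) + 2 := by omega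
  have e2 : 2 * (k + 1) + 4 - 2 * max 0 1 = 2 * (k + 1) + 2 := by omega
  have e3 : 2 * (k + 1) + 4 - 2 * (k + 1 + 1) = 2 := by omega
  have e4 : 2 * (k + 1) + 4 - 2 * (0 + 1) = 2 * (k + 1) + 2 := by omega
  rw [e1, e2, e3, e4]
  simp only [zero_add, Nat.choose_one_right, Nat.choose_zero_right, Nat.choose_self, nsmul_eq_mul]
  push_cast
  ring

theorem not_isInterpolating_of_coeff {p : ℤ[X]} {i j k : ℕ} (hij : i ≤ j) (hjk : j ≤ k)
    (hi : p.coeff i ≠ 0) (hj : p.coeff j = 0) (hk : p.coeff k ≠ 0) : ¬ IsInterpolating p :=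
  fun h => mem_support_iff.1
    (h.out (mem_support_iff.2 hi) (mem_support_iff.2 hk) ⟨hij, hjk⟩) hj

theorem theorem3p6 (n : ℕ) (hn : 1 ≤ n) :
    (bouquetC n).partialDualEulerGenusPoly =
        2 ^ (n + 1) * ((n : ℤ[X]) + 2) * X ^ (2 * n + 2)
        + ∑ s ∈ Finset.Icc 2 n,
            2 ^ (n + 1) * ((n.choose s : ℤ[X]) + (n.choose (s - 1) : ℤ[X])) * X ^ (2 * n - 2 * s + 4)
        + 2 ^ (n + 1) * X ^ 2
      ∧ ¬ (bouquetC n).Orientable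
      ∧ ¬ IsInterpolating (bouquetC n).partialDualEulerGenusPoly := by
  have hpoly : (bouquetC n).partialDualEulerGenusPoly =
        2 ^ (n + 1) * ((n : ℤ[X]) + 2) * X ^ (2 * n + 2)
        + ∑ s ∈ Finset.Icc 2 n,
            2 ^ (n + 1) * ((n.choose s : ℤ[X]) + (n.choose (s - 1) : ℤ[X])) * X ^ (2 * n - 2 * s + 4)
        + 2 ^ (n + 1) * X ^ 2 := by
    rw [partialDualEulerGenusPoly_bouquetC, sum_choose_eq n hn, mul_add, mul_add, Finset.mul_sum]
    simp only [mul_assoc]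
  refine ⟨hpoly, not_orientable_bouquetC n, ?_⟩
  have hC : (bouquetC n).partialDualEulerGenusPoly =
        C (2 ^ (n + 1) * ((n : ℤ) + 2)) * X ^ (2 * n + 2)
        + ∑ s ∈ Finset.Icc 2 n,
            C (2 ^ (n + 1) * ((n.choose s : ℤ) + (n.choose (s - 1) : ℤ))) *
              X ^ (2 * n - 2 * s + 4)
        + C (2 ^ (n + 1)) * X ^ 2 := by
    rw [hpoly]
    simp
  have hcoeff : ∀ k, (∀ s ∈ Finset.Icc 2 n, k ≠ 2 * n - 2 * s + 4) →
      (bouquetC n).partialDualEulerGenusPoly.coeff k =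
        (if k = 2 * n + 2 then 2 ^ (n + 1) * ((n : ℤ) + 2) else 0) +
          if k = 2 then 2 ^ (n + 1) else 0 := by
    intro k hk
    rw [hC, coeff_add, coeff_add, finsetSum_coeff, Finset.sum_eq_zero, coeff_C_mul_X_pow,
      coeff_C_mul_X_pow, add_zero]
    intro s hs
    rw [coeff_C_mul_X_pow, if_neg (hk s hs)]
  -- The middle exponents `2n - 2s + 4` are even and lie between `4` and `2n`, so they affect none
  -- of these three coefficients.
  refine not_isInterpolating_of_coeff (i := 2) (j := 3) (k := 2 * n + 2) (by omega) (by omega)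
    ?_ ?_ ?_
  · rw [hcoeff _ (fun s _ => by omega), if_neg (by omega), if_pos rfl, zero_add]
    positivity
  · rw [hcoeff _ (fun s _ => by omega), if_neg (by omega), if_neg (by omega), zero_add]
  · rw [hcoeff _ (fun s hs => by rw [Finset.mem_Icc] at hs; omega), if_pos rfl,
      if_neg (by omega), add_zero]
    positivity
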